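/- **Setting.** Let $S$ be a nonempty Borel space (a standard Borel space, carrying its Borel $\sigma$-algebra $\mathcal B(S)$). A (conservative stable) $Q$-function on $S$ is a Borel-measurable finite signed kernel $q(dy|x,s)$ on $\mathcal B(S)$ from $S\times[0,\infty)$ with $q(\Gamma|x,s)\ge 0$ whenever $x\notin\Gamma\in\mathcal B(S)$, $q(S|x,s)=0$, and $\sup_{s\ge0}q(S\setminus\{x\}|x,s)<\infty$ for each $x\in S$. Put $\tilde q(\Gamma|x,s)=q(\Gamma\setminus\{x\}|x,s)$ and $q_x(s)=-q(\{x\}|x,s)$. For $\alpha\ge 0$ let $p^\alpha$ be the transition probability on $([0,\infty)\times S)\cup\{\infty_*\}$, with $\infty_*$ an absorbing isolated cemetery, given for $(v,x)\in[0,\infty)\times S$ and measurable $f\ge 0$ on $[0,\infty)\times S$ by $$\int_{[0,\infty)\times S} f\,dp^\alpha(\cdot|v,x)=\int_0^\infty\int_S f(v+t,y)\,e^{-\alpha t-\int_0^t q_x(v+s)ds}\,\tilde q(dy|x,v+t)\,dt,$$ the remaining mass being placed at $\infty_*$. The nonhomogeneous pure jump process with $Q$-function $q$ started from $x$ at time $0$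 has jump moments and post-jump states $(t_n,x_n)_{n\ge0}$ forming a Markov chain with transition probability $p^0$ and initial value $(t_0,x_0)=(0,x)$ (with $t_n=\infty$ at the cemetery). Let $\mathbb P_x$ be its law and $t_\infty=\lim_n t_n$. The process is nonexplosive if $\mathbb P_x(t_\infty=\infty)=1$ for all $x\in S$. **Drift condition with constant $\alpha>0$, sets $(\tilde S_n)$ and function $V$.** $(\tilde S_n)$ is a nondecreasing sequence of Borel subsets of $[0,\infty)\times S$, $V:[0,\infty)\times S\to[0,\infty)$ is measurable, and 1. $\bigcup_n\tilde S_n=[0,\infty)\times S$; 2. for each $n$, $\sup\{q_x(t): x\in \mathrm{proj}_S\tilde S_n,\ t\ge0\}<\infty$; 3. $\inf_{(t,x)\notin\tilde S_n}V(t,x)\uparrow\infty$ as $n\to\infty$ (with $\inf\emptyset=\infty$); 4. for all $x\in S$ and $v\in[0,\infty)$, $$\int_0^\infty\int_S V(t+v,y)\,e^{-\alpha t-\int_0^t q_x(s+v)ds}\,\tilde q(dy|x,t+v)\,dt\le V(v,x).$$ **Theorem.** Let $q$ be a $Q$-function on $S$. (a) If the drift condition holds with some $\alpha>0$, some $(\tilde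 S_n)$ and some $V$, then the pure jump process is nonexplosive. (b) Suppose in addition that $S$ is a locally compact separable metric space (with $\mathcal B(S)$ its Borel $\sigma$-algebra), that $\sup_{x\in\Gamma,\,t\ge0}q_x(t)<\infty$ for each compact $\Gamma\subseteq S$, and that for a given $\alpha>0$ the transition probability $p^\alpha$ is weakly Feller, i.e. $(v,x)\mapsto\int_{[0,\infty)\times S} f(t,y)\,p^\alpha(dt\times dy|v,x)$ is continuous on $[0,\infty)\times S$ for each bounded continuous $f$ on $[0,\infty)\times S$. If the process is nonexplosive, then the drift condition holds with this $\alpha$, with sets of the form $\tilde S_n=T_n\times S_n$, where $T_n\subseteq[0,\infty)$ and $S_n\subseteq S$ are compact, and with a function $V$ such that $\sup_{(t,x)\in T_n\times S_n}V(t,x)<\infty$ for each $n$. -/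

import Mathlib

open MeasureTheory ProbabilityTheory Set Filter Topology
open scoped NNReal ENNReal

/-- A conservative stable `Q`-function `q(dy|x,s)` on `S`: a Borel-measurable signed kernel from
`S × [0,∞)` to `S`, nonnegative away from the current state, of total mass zero, with jump
intensity bounded in time for each state. (Values of a `SignedMeasure` are finite.) -/
structure QFunction (S : Type*) [MeasurableSpace S] where
  /-- the signed measure `q(dy|x,s)` -/
  toFun : S → ℝ≥0 → SignedMeasure S
  measurable_toFun : ∀ Γ : Set S, MeasurableSet Γ →
    Measurable fun p : S × ℝ≥0 => toFun p.1 p.2 Γ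
  nonneg : ∀ (x : S) (s : ℝ≥0) (Γ : Set S), MeasurableSet Γ → x ∉ Γ → 0 ≤ toFun x s Γ
  conservative : ∀ (x : S) (s : ℝ≥0), toFun x s univ = 0
  stable : ∀ x : S, BddAbove (range fun s : ℝ≥0 => toFun x s (univ \ {x}))

/-- The hazard bound `∫₀^∞ g(r) exp(-∫₀^r g) dr ≤ 1` for bounded measurable `g ≥ 0`. -/
theorem lintegral_hazard_le_one (g : ℝ → ℝ) (hg : Measurable g) (h0 : ∀ r, 0 ≤ g r) (C : ℝ)
    (hC : ∀ r, g r ≤ C) :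
    ∫⁻ r in Ioi (0 : ℝ), ENNReal.ofReal (Real.exp (-∫ s in (0 : ℝ)..r, g s)) *
      ENNReal.ofReal (g r) ≤ 1 := by
  have hint : ∀ a b : ℝ, IntervalIntegrable g volume a b := by
    intro a b
    refine (intervalIntegrable_const (c := C)).mono_fun hg.aestronglyMeasurable ?_
    refine Eventually.of_forall fun r => ?_
    simpa [abs_of_nonneg (h0 r)] using (hC r).trans (le_abs_self C)
  set h : ℝ → ℝ := fun r => -Real.exp (-∫ s in (0 : ℝ)..r, g s) with hh
  have hmono : Monotone h := by
    intro a b hab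
    have : ∫ s in (0 : ℝ)..b, g s = (∫ s in (0 : ℝ)..a, g s) + ∫ s in a..b, g s :=
      (intervalIntegral.integral_add_adjacent_intervals (hint _ _) (hint _ _)).symm
    have h2 : 0 ≤ ∫ s in a..b, g s := intervalIntegral.integral_nonneg hab fun u _ => h0 u
    simp only [hh, neg_le_neg_iff, Real.exp_le_exp]
    linarith
  have hloc : LocallyIntegrable g volume := by
    refine (locallyIntegrable_const C).mono hg.aestronglyMeasurable ?_
    refine Eventually.of_forall fun r => ?_
    rw [Real.norm_of_nonneg (h0 r)]
    exact (hC r).trans (le_abs_self C)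
  have hder : ∀ᵐ r, deriv h r = Real.exp (-∫ s in (0 : ℝ)..r, g s) * g r := by
    filter_upwards [LocallyIntegrable.ae_hasDerivAt_integral hloc] with r hr
    have := ((hr 0).neg.exp.neg).deriv
    simpa [hh] using this
  have hbound : ∀ n : ℕ, ∫⁻ r in Ioc (0 : ℝ) n,
      ENNReal.ofReal (Real.exp (-∫ s in (0 : ℝ)..r, g s)) * ENNReal.ofReal (g r) ≤ 1 := by
    intro n
    have h1 := (hmono.monotoneOn (uIcc (0 : ℝ) n)).intervalIntegral_deriv_mem_uIcc
    have h2 := (hmono.monotoneOn (uIcc (0 : ℝ) n)).intervalIntegrable_deriv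
    have hn : (0 : ℝ) ≤ n := Nat.cast_nonneg n
    rw [uIcc_of_le (by linarith [hmono hn])] at h1
    rw [intervalIntegrable_iff_integrableOn_Ioc_of_le hn] at h2
    rw [intervalIntegral.integral_of_le hn] at h1
    have h3 : ∫⁻ r in Ioc (0 : ℝ) n, ENNReal.ofReal (Real.exp (-∫ s in (0 : ℝ)..r, g s)) *
        ENNReal.ofReal (g r) = ∫⁻ r in Ioc (0 : ℝ) n, ENNReal.ofReal (deriv h r) := by
      refine lintegral_congr_ae (ae_restrict_of_ae ?_)
      filter_upwards [hder] with r hr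
      rw [hr, ENNReal.ofReal_mul (Real.exp_nonneg _)]
    rw [h3, ← ofReal_integral_eq_lintegral_ofReal h2]
    · refine ENNReal.ofReal_le_one.2 (h1.2.trans ?_)
      simp only [hh, intervalIntegral.integral_same, neg_zero, Real.exp_zero]
      linarith [Real.exp_nonneg (-∫ s in (0 : ℝ)..n, g s)]
    · refine ae_restrict_of_ae ?_
      filter_upwards [hder] with r hr
      rw [hr]
      exact mul_nonneg (Real.exp_nonneg _) (h0 r)
  have hU : Ioi (0 : ℝ) = ⋃ n : ℕ, Ioc (0 : ℝ) n := by
    ext r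
    simp only [mem_Ioi, mem_iUnion, mem_Ioc]
    exact ⟨fun hr => (exists_nat_ge r).imp fun n hn => ⟨hr, hn⟩, fun ⟨_, hr, _⟩ => hr⟩
  rw [hU, setLIntegral_iUnion_of_directed]
  · exact iSup_le hbound
  · refine (monotone_nat_of_le_succ fun n => ?_).directed_le
    exact Ioc_subset_Ioc_right (by push_cast; linarith)

namespace QFunction

variable {S : Type*} [MeasurableSpace S]

/-- The total jump rate `q_x(s) = -q({x}|x,s)`. -/
noncomputable def rate (q : QFunction S) (x : S) (s : ℝ≥0) : ℝ := -q.toFun x s {x}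

theorem measurable_section (q : QFunction S) {D : Set (S × S)} (hD : MeasurableSet D) :
    Measurable fun p : S × ℝ≥0 => q.toFun p.1 p.2 (Prod.mk p.1 ⁻¹' D) := by
  induction D, hD using MeasurableSpace.induction_on_inter
    (generateFrom_prod (α := S) (β := S)).symm isPiSystem_prod with
  | empty => simp
  | basic t ht =>
    obtain ⟨A, hA, B, hB, rfl⟩ := ht
    have hA : MeasurableSet A := hA
    have hB : MeasurableSet B := hB
    have h : (fun p : S × ℝ≥0 => q.toFun p.1 p.2 (Prod.mk p.1 ⁻¹' A ×ˢ B)) =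
        (Prod.fst ⁻¹' A : Set (S × ℝ≥0)).indicator fun p => q.toFun p.1 p.2 B := by
      classical
      ext p
      by_cases hp : p.1 ∈ A
      · rw [indicator_of_mem (by exact hp), mk_preimage_prod_right hp]
      · rw [indicator_of_notMem (by exact hp), mk_preimage_prod_right_eq_empty hp,
          VectorMeasure.empty]
    rw [h]
    exact (q.measurable_toFun B hB).indicator (measurable_fst hA)
  | compl t ht ih =>
    have h : (fun p : S × ℝ≥0 => q.toFun p.1 p.2 (Prod.mk p.1 ⁻¹' tᶜ)) =
        fun p => -q.toFun p.1 p.2 (Prod.mk p.1 ⁻¹' t) := by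
      ext p
      have hm : MeasurableSet (Prod.mk p.1 ⁻¹' t) := measurable_prodMk_left ht
      have := (q.toFun p.1 p.2).of_add_of_sdiff hm MeasurableSet.univ (subset_univ _)
      rw [q.conservative, ← compl_eq_univ_sdiff] at this
      rw [preimage_compl]
      linarith
    rw [h]
    exact ih.neg
  | iUnion f hd hf ih =>
    have h : ∀ p : S × ℝ≥0, HasSum (fun i => q.toFun p.1 p.2 (Prod.mk p.1 ⁻¹' f i))
        (q.toFun p.1 p.2 (Prod.mk p.1 ⁻¹' ⋃ i, f i)) := by
      intro p
      rw [preimage_iUnion]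
      exact (q.toFun p.1 p.2).m_iUnion (fun i => measurable_prodMk_left (hf i))
        fun i j hij => (hd hij).preimage _
    refine measurable_of_tendsto_metrizable (f := fun n (p : S × ℝ≥0) =>
      ∑ i ∈ Finset.range n, q.toFun p.1 p.2 (Prod.mk p.1 ⁻¹' f i)) ?_ ?_
    · exact fun n => Finset.measurable_sum _ fun i _ => ih i
    · exact tendsto_pi_nhds.2 fun p => (h p).tendsto_sum_nat

theorem restrict_compl_nonneg (q : QFunction S) (x : S) (s : ℝ≥0) :
    VectorMeasure.restrict 0 {x}ᶜ ≤ (q.toFun x s).restrict {x}ᶜ := by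
  refine VectorMeasure.restrict_le_restrict_of_subset_le _ _ fun Γ hΓ hsub => ?_
  exact q.nonneg x s Γ hΓ fun hx => hsub hx rfl

variable [MeasurableEq S]

theorem measurable_rate (q : QFunction S) : Measurable fun p : S × ℝ≥0 => q.rate p.1 p.2 := by
  have h := q.measurable_section (D := {p : S × S | p.2 = p.1})
    (measurableSet_eq_fun measurable_snd measurable_fst)
  exact h.neg

theorem rate_eq (q : QFunction S) (x : S) (s : ℝ≥0) :
    q.rate x s = q.toFun x s (univ \ {x}) := by
  have := (q.toFun x s).of_add_of_sdiff (measurableSet_singleton x) MeasurableSet.univ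
    (subset_univ _)
  rw [q.conservative] at this
  rw [rate]
  linarith

theorem rate_nonneg (q : QFunction S) (x : S) (s : ℝ≥0) : 0 ≤ q.rate x s := by
  rw [rate_eq]
  exact q.nonneg x s _ (MeasurableSet.univ.diff (measurableSet_singleton x)) (by simp)

theorem toMeasure_eq (q : QFunction S) (x : S) (s : ℝ≥0) {Γ : Set S} (hΓ : MeasurableSet Γ) :
    (q.toFun x s).toMeasureOfZeroLE {x}ᶜ (measurableSet_singleton x).compl
      (q.restrict_compl_nonneg x s) Γ = ENNReal.ofReal (q.toFun x s (Γ \ {x})) := by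
  have h : {x}ᶜ ∩ Γ = Γ \ {x} := by rw [inter_comm, ← sdiff_eq]
  rw [SignedMeasure.toMeasureOfZeroLE_apply _ _ _ hΓ, ENNReal.ofReal, ENNReal.coe_inj]
  ext
  rw [NNReal.coe_mk, h, Real.coe_toNNReal _ (q.nonneg x s _
    (hΓ.diff (measurableSet_singleton x)) (by simp))]

/-- The jump measure `q̃(Γ|x,s) = q(Γ \ {x}|x,s)`, as a kernel from `S × [0,∞)` to `S`. -/
noncomputable def jumpRate (q : QFunction S) : Kernel (S × ℝ≥0) S where
  toFun p := (q.toFun p.1 p.2).toMeasureOfZeroLE {p.1}ᶜ (measurableSet_singleton p.1).compl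
    (q.restrict_compl_nonneg p.1 p.2)
  measurable' := by
    refine Measure.measurable_of_measurable_coe _ fun Γ hΓ => ?_
    have h := (q.measurable_section (D := Prod.snd ⁻¹' Γ \ {p : S × S | p.2 = p.1})
      ((measurable_snd hΓ).diff (measurableSet_eq_fun measurable_snd measurable_fst)))
    have h2 : (fun p : S × ℝ≥0 => (q.toFun p.1 p.2).toMeasureOfZeroLE {p.1}ᶜ
        (measurableSet_singleton p.1).compl (q.restrict_compl_nonneg p.1 p.2) Γ) =
        fun p => ENNReal.ofReal (q.toFun p.1 p.2
          (Prod.mk p.1 ⁻¹' (Prod.snd ⁻¹' Γ \ {p : S × S | p.2 = p.1}))) := by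
      funext p
      exact q.toMeasure_eq p.1 p.2 hΓ
    exact h2 ▸ h.ennreal_ofReal

theorem jumpRate_apply (q : QFunction S) (x : S) (s : ℝ≥0) {Γ : Set S} (hΓ : MeasurableSet Γ) :
    q.jumpRate (x, s) Γ = ENNReal.ofReal (q.toFun x s (Γ \ {x})) :=
  q.toMeasure_eq x s hΓ

theorem jumpRate_univ (q : QFunction S) (x : S) (s : ℝ≥0) :
    q.jumpRate (x, s) univ = ENNReal.ofReal (q.rate x s) := by
  rw [jumpRate_apply _ _ _ MeasurableSet.univ, rate_eq]

instance (q : QFunction S) (p : S × ℝ≥0) : IsFiniteMeasure (q.jumpRate p) :=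
  ⟨by rw [show p = (p.1, p.2) from rfl, jumpRate_univ]; exact ENNReal.ofReal_lt_top⟩

instance (q : QFunction S) : IsSFiniteKernel q.jumpRate := by
  classical
  have hA : ∀ n : ℕ, MeasurableSet {p : S × ℝ≥0 | ⌊q.rate p.1 p.2⌋₊ = n} := fun n =>
    (Nat.measurable_floor.comp q.measurable_rate) (measurableSet_singleton n)
  have hfin : ∀ n : ℕ, IsFiniteKernel (Kernel.piecewise (hA n) q.jumpRate 0) := by
    intro n
    refine ⟨ENNReal.ofReal (n + 1), ENNReal.ofReal_lt_top, fun p => ?_⟩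
    rw [Kernel.piecewise_apply]
    split_ifs with hp
    · rw [show p = (p.1, p.2) from rfl, jumpRate_univ]
      refine ENNReal.ofReal_le_ofReal ?_
      have := Nat.lt_floor_add_one (q.rate p.1 p.2)
      rw [show ⌊q.rate p.1 p.2⌋₊ = n from hp] at this
      exact this.le
    · simp
  have hsum : q.jumpRate = Kernel.sum fun n : ℕ => Kernel.piecewise (hA n) q.jumpRate 0 := by
    ext p Γ hΓ
    rw [Kernel.sum_apply' _ _ hΓ, tsum_eq_single ⌊q.rate p.1 p.2⌋₊]
    · simp [Kernel.piecewise_apply]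
    · intro n hn
      simp [Kernel.piecewise_apply, hn.symm]
  rw [hsum]
  infer_instance

/-- The discounted survival probability `exp(-α t - ∫₀ᵗ q_x(v + s) ds)`. -/
noncomputable def survival (q : QFunction S) (α : ℝ≥0) (z : ℝ≥0 × S) (t : ℝ) : ℝ :=
  Real.exp (-(α * t) - ∫ s in (0 : ℝ)..t, q.rate z.2 (z.1 + s.toNNReal))

theorem measurable_survival (q : QFunction S) (α : ℝ≥0) :
    Measurable fun p : (ℝ≥0 × S) × ℝ => q.survival α p.1 p.2 := by
  have hr : Measurable fun p : ((ℝ≥0 × S) × ℝ) × ℝ =>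
      q.rate p.1.1.2 (p.1.1.1 + p.2.toNNReal) :=
    q.measurable_rate.comp (f := fun p : ((ℝ≥0 × S) × ℝ) × ℝ =>
      (p.1.1.2, p.1.1.1 + p.2.toNNReal)) (by fun_prop)
  have key : ∀ a b : ((ℝ≥0 × S) × ℝ) → ℝ, Measurable a → Measurable b →
      Measurable fun p : (ℝ≥0 × S) × ℝ =>
        ∫ s in Ioc (a p) (b p), q.rate p.1.2 (p.1.1 + s.toNNReal) := by
    intro a b ha hb
    have hD : MeasurableSet {p : ((ℝ≥0 × S) × ℝ) × ℝ | p.2 ∈ Ioc (a p.1) (b p.1)} :=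
      (measurableSet_lt (ha.comp measurable_fst) measurable_snd).inter
        (measurableSet_le measurable_snd (hb.comp measurable_fst))
    have := ((hr.indicator hD).stronglyMeasurable.integral_prod_right' (ν := volume)).measurable
    have e : (fun p : (ℝ≥0 × S) × ℝ =>
        ∫ s in Ioc (a p) (b p), q.rate p.1.2 (p.1.1 + s.toNNReal)) = _ :=
      funext fun p => (integral_indicator measurableSet_Ioc).symm
    rw [e]
    exact this
  unfold survival intervalIntegral
  refine Real.measurable_exp.comp ?_
  exact ((measurable_const.mul measurable_snd).neg).sub
    ((key _ _ measurable_const measurable_snd).sub (key _ _ measurable_snd measurable_const))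

/-- The law of the waiting time and the new state when the current (time, state) is `(v, x)`:
`exp(-α t - ∫₀ᵗ q_x(v+s) ds) q̃(dy|x,v+t) dt` on `(0,∞) × S`; it may have mass less than one. -/
noncomputable def waitKernel (q : QFunction S) (α : ℝ≥0) : Kernel (ℝ≥0 × S) (ℝ × S) :=
  ((Kernel.const (ℝ≥0 × S) (volume.restrict (Ioi (0 : ℝ)))).withDensity
      fun z t => ENNReal.ofReal (q.survival α z t)) ⊗ₖ
    q.jumpRate.comap (fun p : (ℝ≥0 × S) × ℝ => (p.1.2, p.1.1 + p.2.toNNReal)) (by fun_prop)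

instance (q : QFunction S) (α : ℝ≥0) : IsSFiniteKernel (q.waitKernel α) := by
  have : IsSFiniteKernel ((Kernel.const (ℝ≥0 × S) (volume.restrict (Ioi (0 : ℝ)))).withDensity
      fun z t => ENNReal.ofReal (q.survival α z t)) :=
    Kernel.IsSFiniteKernel.withDensity _ fun _ _ => ENNReal.ofReal_ne_top
  unfold waitKernel
  infer_instance

/-- The part on `[0,∞) × S` of the transition probability `p^α(·|v,x)` of the embedded chain:
from time `v` and state `x`, jump after a waiting time `t` to time `v + t` and state `y`, with
intensity `exp(-α t - ∫₀ᵗ q_x(v+s) ds) q̃(dy|x,v+t) dt`. -/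
noncomputable def jumpKernel (q : QFunction S) (α : ℝ≥0) : Kernel (ℝ≥0 × S) (ℝ≥0 × S) :=
  (Kernel.id ×ₖ q.waitKernel α).map
    fun p : (ℝ≥0 × S) × (ℝ × S) => (p.1.1 + p.2.1.toNNReal, p.2.2)

theorem lintegral_jumpKernel (q : QFunction S) (α : ℝ≥0) (v : ℝ≥0) (x : S)
    {f : ℝ≥0 × S → ℝ≥0∞} (hf : Measurable f) :
    ∫⁻ w, f w ∂q.jumpKernel α (v, x) = ∫⁻ t in Ioi (0 : ℝ), ∫⁻ y,
      f (v + t.toNNReal, y) * ENNReal.ofReal (q.survival α (v, x) t)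
        ∂q.jumpRate (x, v + t.toNNReal) := by
  have hm : Measurable fun p : (ℝ≥0 × S) × (ℝ × S) => (p.1.1 + p.2.1.toNNReal, p.2.2) := by
    fun_prop
  have hd : Measurable (Function.uncurry fun (z : ℝ≥0 × S) (t : ℝ) =>
      ENNReal.ofReal (q.survival α z t)) := (q.measurable_survival α).ennreal_ofReal
  have hf2 : Measurable fun c : ℝ × S => f (v + c.1.toNNReal, c.2) := hf.comp (by fun_prop)
  have : IsSFiniteKernel ((Kernel.const (ℝ≥0 × S) (volume.restrict (Ioi (0 : ℝ)))).withDensity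
      fun z t => ENNReal.ofReal (q.survival α z t)) :=
    Kernel.IsSFiniteKernel.withDensity _ fun _ _ => ENNReal.ofReal_ne_top
  rw [jumpKernel, Kernel.lintegral_map _ hm _ hf, Kernel.lintegral_id_prod
      (f := fun p : (ℝ≥0 × S) × (ℝ × S) => f (p.1.1 + p.2.1.toNNReal, p.2.2)) (hf.comp hm),
    waitKernel, Kernel.lintegral_compProd _ _ _ hf2, Kernel.lintegral_withDensity _ hd]
  · simp only [Kernel.const_apply, Kernel.comap_apply]
    refine lintegral_congr fun t => ?_
    rw [lintegral_mul_const, mul_comm]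
    exact hf2.comp measurable_prodMk_left
  · exact Measurable.lintegral_kernel_prod_right' (κ := q.jumpRate.comap
      (fun t : ℝ => (x, v + t.toNNReal)) (by fun_prop)) hf2

theorem jumpKernel_univ_le_one (q : QFunction S) (α : ℝ≥0) (z : ℝ≥0 × S) :
    q.jumpKernel α z univ ≤ 1 := by
  obtain ⟨v, x⟩ := z
  obtain ⟨C, hC⟩ := q.stable x
  rw [← lintegral_one, lintegral_jumpKernel _ _ _ _ measurable_const]
  simp only [one_mul, lintegral_const, jumpRate_univ]
  have hg : Measurable fun s : ℝ => q.rate x (v + s.toNNReal) :=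
    q.measurable_rate.comp (f := fun s : ℝ => (x, v + s.toNNReal)) (by fun_prop)
  refine le_trans ?_ (lintegral_hazard_le_one (fun s => q.rate x (v + s.toNNReal)) hg
    (fun s => q.rate_nonneg _ _) C fun s => ?_)
  · refine setLIntegral_mono' measurableSet_Ioi fun t ht => ?_
    refine mul_le_mul_left (ENNReal.ofReal_le_ofReal (Real.exp_le_exp.2 ?_)) _
    have : 0 ≤ (α : ℝ) * t := mul_nonneg α.2 (le_of_lt ht)
    simp only
    linarith
  · rw [rate_eq]
    exact hC ⟨_, rfl⟩

/-- The transition probability `p^α` of the embedded chain on `([0,∞) × S) ∪ {cemetery}`: the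
missing mass of `jumpKernel` goes to the absorbing cemetery `Sum.inr ()`. For `α = 0` this is the
transition probability of the sequence (jump moment, post-jump state) of the pure jump process,
the cemetery meaning that no further jump occurs. -/
noncomputable def chainKernel (q : QFunction S) (α : ℝ≥0) :
    Kernel ((ℝ≥0 × S) ⊕ Unit) ((ℝ≥0 × S) ⊕ Unit) where
  toFun := Sum.elim
    (fun z => (q.jumpKernel α z).map Sum.inl +
      (1 - q.jumpKernel α z univ) • Measure.dirac (Sum.inr ()))
    (fun u => Measure.dirac (Sum.inr u))
  measurable' := by
    refine Measurable.sumElim (Measure.measurable_of_measurable_coe _ fun Γ hΓ => ?_)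
      measurable_from_top
    simp only [Measure.add_apply, Measure.smul_apply, smul_eq_mul,
      Measure.map_apply measurable_inl hΓ]
    exact (Kernel.measurable_coe _ (measurable_inl hΓ)).add
      ((measurable_const.sub (Kernel.measurable_coe _ MeasurableSet.univ)).mul_const _)

instance (q : QFunction S) (α : ℝ≥0) : IsMarkovKernel (q.chainKernel α) := by
  refine ⟨fun w => ⟨?_⟩⟩
  rcases w with z | u
  · change ((q.jumpKernel α z).map Sum.inl +
      (1 - q.jumpKernel α z univ) • Measure.dirac (Sum.inr ()) :
        Measure ((ℝ≥0 × S) ⊕ Unit)) univ = 1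
    simp only [Measure.add_apply, Measure.smul_apply, smul_eq_mul, measure_univ, mul_one,
      Measure.map_apply measurable_inl MeasurableSet.univ, preimage_univ]
    exact add_tsub_cancel_of_le (q.jumpKernel_univ_le_one α z)
  · change Measure.dirac (Sum.inr u) univ = 1
    simp

/-- The law `ℙ_x` of the sequence `(t_n, x_n)` of jump moments and post-jump states of the pure
jump process with `Q`-function `q` started from `x` at time `0`: given `(t_n, x_n)` and the past,
the next jump occurs at `t_n + t` into `dy` with intensity
`exp(-∫₀ᵗ q_{x_n}(t_n+s) ds) q̃(dy|x_n,t_n+t) dt`. -/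
noncomputable def pathLaw (q : QFunction S) (x : S) : Measure (ℕ → (ℝ≥0 × S) ⊕ Unit) :=
  Kernel.traj (X := fun _ => (ℝ≥0 × S) ⊕ Unit)
    (fun n => (q.chainKernel 0).comap (fun h => h ⟨n, Finset.mem_Iic.2 le_rfl⟩)
      (measurable_pi_apply _)) 0
    fun _ => Sum.inl (0, x)

/-- The jump moment recorded in a state of the chain; it is `∞` at the cemetery. -/
noncomputable def jumpMoment : (ℝ≥0 × S) ⊕ Unit → ℝ≥0∞ :=
  Sum.elim (fun z => (z.1 : ℝ≥0∞)) (fun _ => ∞)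

/-- The pure jump process is nonexplosive: from every initial state, the accumulation point
`t_∞` of the jump moments is almost surely infinite. -/
def Nonexplosive (q : QFunction S) : Prop :=
  ∀ x : S, q.pathLaw x {ω | ⨆ n, jumpMoment (ω n) = ∞} = 1

/-- The drift condition with discount `α`, exhausting Borel sets `St n ⊆ [0,∞) × S` and measurable
test function `V ≥ 0`: the rates are bounded over the projection of each `St n` on `S`, uniformly
in time; the infimum of `V` off `St n` (`∞` over the empty set) tends to `∞`; and the integral
drift inequality holds. -/
structure Drift (q : QFunction S) (α : ℝ≥0) (St : ℕ → Set (ℝ≥0 × S)) (V : ℝ≥0 × S → ℝ≥0) :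
    Prop where
  measurableSet (n : ℕ) : MeasurableSet (St n)
  measurable : Measurable V
  monotone : Monotone St
  iUnion_eq : ⋃ n, St n = univ
  rate_bounded (n : ℕ) : ∃ C : ℝ, ∀ x ∈ Prod.snd '' St n, ∀ t : ℝ≥0, q.rate x t ≤ C
  tendsto_iInf : Tendsto (fun n => ⨅ z ∈ (St n)ᶜ, (V z : ℝ≥0∞)) atTop (𝓝 ∞)
  drift (v : ℝ≥0) (x : S) :
    ∫⁻ t in Ioi (0 : ℝ), ∫⁻ y, V (v + t.toNNReal, y) *
        ENNReal.ofReal (Real.exp (-(α * t) - ∫ s in (0 : ℝ)..t, q.rate x (v + s.toNNReal)))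
      ∂q.jumpRate (x, v + t.toNNReal) ≤ V (v, x)

/-- The drift condition: it holds for some `α > 0`, some sets and some test function. -/
def DriftCondition (q : QFunction S) : Prop :=
  ∃ α : ℝ≥0, 0 < α ∧ ∃ (St : ℕ → Set (ℝ≥0 × S)) (V : ℝ≥0 × S → ℝ≥0), q.Drift α St V

/-- `p^α` is weakly Feller: integration of bounded continuous functions on `[0,∞) × S` against
`p^α(·|v,x)` gives continuous functions of `(v,x)`. -/
def WeaklyFeller [TopologicalSpace S] (q : QFunction S) (α : ℝ≥0) : Prop :=
  ∀ f : BoundedContinuousFunction (ℝ≥0 × S) ℝ,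
    Continuous fun z : ℝ≥0 × S => ∫ w, f w ∂q.jumpKernel α z

end QFunction

/-!
Write `P` for the operator `f ↦ ∫ f dp^α` on nonnegative functions (`kernelOp`). Since `p^α` is
`p^0` discounted by `e^{-α (t' - t)}`, the mass `P^n 1 (0, x)` is the expectation of `e^{-α t_n}`
under `ℙ_x`. As the jump moments increase to `t_∞`, nonexplosion is equivalent to `P^n 1 (0, x) → 0`
for all `x` (`QFunction.nonexplosive_iff_tendsto`). Both halves of the theorem are then statements
about the sub-Markov kernel `p^α`, where the drift inequality reads `P V ≤ V`.

Drift implies nonexplosion (`tendsto_kernelOp_iterate_one`): on a set where the rates are at most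
`C`, one has `P 1 ≤ θ = C / (C + α) < 1`; off it, `ε V ≥ 1` if the set is large enough. Induction on
`k` gives `P^k 1 ≤ θ^k + ε V`, and `ε` is arbitrary.

For the converse, nonexplosion from time `0` first gives `P^n 1 → 0` at every `(v, x)`, because the
process started from `x` at time `0` stays in `x` until time `v` with positive probability
(`QFunction.Nonexplosive.tendsto`). For a cutoff function `φ` that vanishes on a compact set and is
one off a larger one, the function `r = inf_N (∑_{k < N} P^k φ + P^N 1)` satisfies `φ ≤ r ≤ 1` and
`P r ≤ r`. By the Feller property and Dini's theorem, `r` is uniformly small on a given compact set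
when `φ` vanishes on a sufficiently large one (`exists_forall_excessiveMajorant_le`). The test
function `V` is a sum of such functions `r`, with the cutoffs chosen so that the series converges
uniformly on compact sets (`exists_excessive_of_tendsto`).
-/

/-! ### Sub-Markov kernels as operators on nonnegative functions -/

section KernelOp

variable {X : Type*} [MeasurableSpace X] {κ : Kernel X X}

/-- The operator `f ↦ (z ↦ ∫ f dκ(z))` induced by a kernel on `[0,∞]`-valued functions. It is
positive and monotone for all `f`; additivity needs measurability. -/
noncomputable def kernelOp (κ : Kernel X X) (f : X → ℝ≥0∞) (z : X) : ℝ≥0∞ := ∫⁻ w, f w ∂κ z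

theorem measurable_kernelOp {f : X → ℝ≥0∞} (hf : Measurable f) : Measurable (kernelOp κ f) :=
  hf.lintegral_kernel

theorem measurable_kernelOp_iterate {f : X → ℝ≥0∞} (hf : Measurable f) (n : ℕ) :
    Measurable ((kernelOp κ)^[n] f) := by
  induction n with
  | zero => exact hf
  | succ n ih => rw [Function.iterate_succ_apply']; exact measurable_kernelOp ih

theorem kernelOp_mono : Monotone (kernelOp κ) := fun _ _ h _ => lintegral_mono h

theorem kernelOp_iterate_le_one (hκ : ∀ z, κ z univ ≤ 1) {f : X → ℝ≥0∞} (hf : f ≤ 1) (n : ℕ) :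
    (kernelOp κ)^[n] f ≤ 1 := by
  induction n with
  | zero => exact hf
  | succ n ih =>
    rw [Function.iterate_succ_apply']
    intro z
    refine (kernelOp_mono ih z).trans ?_
    simpa [kernelOp] using hκ z

theorem antitone_kernelOp_iterate_one (hκ : ∀ z, κ z univ ≤ 1) :
    Antitone fun n => (kernelOp κ)^[n] 1 := by
  refine antitone_nat_of_succ_le fun n => ?_
  rw [Function.iterate_succ_apply]
  exact kernelOp_mono.iterate n (kernelOp_iterate_le_one hκ le_rfl 1)

theorem tendsto_kernelOp_iterate_zero (hκ : ∀ z, κ z univ ≤ 1) {φ : ℕ → X → ℝ≥0∞}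
    (hφ : ∀ n, Measurable (φ n)) (hφ1 : ∀ n, φ n ≤ 1)
    (hlim : ∀ z, Tendsto (fun n => φ n z) atTop (𝓝 0)) (k : ℕ) (z : X) :
    Tendsto (fun n => (kernelOp κ)^[k] (φ n) z) atTop (𝓝 0) := by
  induction k generalizing z with
  | zero => exact hlim z
  | succ k ih =>
    simp only [Function.iterate_succ_apply']
    have h := tendsto_lintegral_of_dominated_convergence (μ := κ z)
      (F := fun n w => (kernelOp κ)^[k] (φ n) w) (f := fun _ => 0) 1
      (fun n => measurable_kernelOp_iterate (hφ n) k)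
      (fun n => Eventually.of_forall (kernelOp_iterate_le_one hκ (hφ1 n) k))
      (by simpa using ((hκ z).trans_lt ENNReal.one_lt_top).ne)
      (Eventually.of_forall ih)
    rwa [lintegral_zero] at h

/-- A Lyapunov criterion for extinction: `V` is excessive and tends to infinity off the sets `St n`,
and on each `St n` the mass of the kernel is bounded away from one. Then `κ^k 1` is at most
`θ ^ k + ε V`, where `θ` bounds the mass on a set off which `ε V ≥ 1`. -/
theorem tendsto_kernelOp_iterate_one (hκ : ∀ z, κ z univ ≤ 1) {St : ℕ → Set X} {V : X → ℝ≥0}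
    (hV : Measurable V) (hdrift : kernelOp κ (fun z => (V z : ℝ≥0∞)) ≤ fun z => (V z : ℝ≥0∞))
    (hmass : ∀ n, ∃ θ : ℝ≥0∞, θ < 1 ∧ ∀ z ∈ St n, κ z univ ≤ θ)
    (hinf : Tendsto (fun n => ⨅ z ∈ (St n)ᶜ, (V z : ℝ≥0∞)) atTop (𝓝 ∞)) (z : X) :
    Tendsto (fun n => (kernelOp κ)^[n] 1 z) atTop (𝓝 0) := by
  have key : ∀ ε : ℝ≥0∞, 0 < ε → ε ≠ ∞ → ∃ θ : ℝ≥0∞, θ < 1 ∧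
      ∀ k z, (kernelOp κ)^[k] 1 z ≤ θ ^ k + ε * V z := by
    intro ε hε hε'
    obtain ⟨n, hn⟩ := (hinf.eventually (lt_mem_nhds
      (ENNReal.inv_lt_top.2 hε))).exists
    obtain ⟨θ, hθ, hm⟩ := hmass n
    refine ⟨θ, hθ, fun k => ?_⟩
    induction k with
    | zero => intro z; simp
    | succ k ih =>
      intro z
      by_cases hz : z ∈ St n
      · rw [Function.iterate_succ_apply']
        calc kernelOp κ ((kernelOp κ)^[k] 1) z
            ≤ ∫⁻ w, (θ ^ k + ε * V w) ∂κ z := kernelOp_mono (fun w => ih w) z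
          _ = θ ^ k * κ z univ + ε * ∫⁻ w, V w ∂κ z := by
              rw [lintegral_add_left measurable_const, lintegral_const,
                lintegral_const_mul _ hV.coe_nnreal_ennreal]
          _ ≤ θ ^ k * θ + ε * V z := by
              gcongr
              · exact hm z hz
              · exact hdrift z
          _ = θ ^ (k + 1) + ε * V z := by rw [pow_succ]
      · refine (kernelOp_iterate_le_one hκ le_rfl _ z).trans (le_add_left ?_)
        have h1 : ε⁻¹ ≤ V z := hn.le.trans (iInf₂_le z hz)
        calc (1 : ℝ≥0∞) = ε * ε⁻¹ := (ENNReal.mul_inv_cancel hε.ne' hε').symm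
          _ ≤ ε * V z := by gcongr
  rw [ENNReal.tendsto_nhds_zero]
  intro δ hδ
  have hδ2 : δ / 2 ≠ 0 := (ENNReal.half_pos hδ.ne').ne'
  have hmin : min (δ / 2) 1 ≠ 0 := by simpa using hδ.ne'
  obtain ⟨θ, hθ, h⟩ := key (min (δ / 2) 1 / (V z + 1)) (ENNReal.div_pos hmin (by simp))
    (ENNReal.div_ne_top (by simp) (by simp))
  filter_upwards [ENNReal.tendsto_nhds_zero.1 (ENNReal.tendsto_pow_atTop_nhds_zero_of_lt_one hθ)
    (δ / 2) hδ2.bot_lt] with k hk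
  refine (h k z).trans ?_
  refine (add_le_add hk ?_).trans (ENNReal.add_halves δ).le
  calc min (δ / 2) 1 / (V z + 1) * V z ≤ min (δ / 2) 1 / (V z + 1) * (V z + 1) := by
        gcongr; exact le_self_add
    _ ≤ δ / 2 := by
        rw [ENNReal.div_mul_cancel (by simp) (by simp)]; exact min_le_left _ _

/-- An excessive majorant of `φ`: the infimum over `N` of the expected number of visits counted by
`φ` before step `N` plus the probability of surviving `N` steps. -/
noncomputable def excessiveMajorant (κ : Kernel X X) (φ : X → ℝ≥0∞) (z : X) : ℝ≥0∞ :=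
  ⨅ N : ℕ, (∑ k ∈ Finset.range N, (kernelOp κ)^[k] φ z + (kernelOp κ)^[N] 1 z)

theorem measurable_excessiveMajorant {φ : X → ℝ≥0∞} (hφ : Measurable φ) :
    Measurable (excessiveMajorant κ φ) :=
  .iInf fun N => (Finset.measurable_sum _ fun k _ => measurable_kernelOp_iterate hφ k).add
    (measurable_kernelOp_iterate measurable_one N)

theorem excessiveMajorant_le_one (φ : X → ℝ≥0∞) : excessiveMajorant κ φ ≤ 1 :=
  fun z => (iInf_le _ 0).trans (by simp)

theorem le_excessiveMajorant {φ : X → ℝ≥0∞} (hφ : φ ≤ 1) : φ ≤ excessiveMajorant κ φ := by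
  refine fun z => le_iInf fun N => ?_
  cases N with
  | zero => simpa using hφ z
  | succ N =>
    refine le_add_right ?_
    exact Finset.single_le_sum (f := fun k => (kernelOp κ)^[k] φ z) (fun _ _ => zero_le)
      (Finset.mem_range.2 N.succ_pos)

theorem kernelOp_excessiveMajorant_le (hκ : ∀ z, κ z univ ≤ 1) {φ : X → ℝ≥0∞}
    (hφ : Measurable φ) : kernelOp κ (excessiveMajorant κ φ) ≤ excessiveMajorant κ φ := by
  refine fun z => le_iInf fun N => ?_
  cases N with
  | zero =>
    simpa using kernelOp_iterate_le_one hκ (excessiveMajorant_le_one φ) 1 z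
  | succ N =>
    -- Applying the operator to the `N`-th bound shifts its sum by one term.
    calc kernelOp κ (excessiveMajorant κ φ) z
        ≤ ∫⁻ w, (∑ k ∈ Finset.range N, (kernelOp κ)^[k] φ w + (kernelOp κ)^[N] 1 w) ∂κ z :=
          lintegral_mono fun w => iInf_le _ N
      _ = ∑ k ∈ Finset.range N, (kernelOp κ)^[k + 1] φ z + (kernelOp κ)^[N + 1] 1 z := by
          rw [lintegral_add_right _ (measurable_kernelOp_iterate measurable_one N),
            lintegral_finsetSum _ fun k _ => measurable_kernelOp_iterate hφ k]
          simp only [Function.iterate_succ_apply', kernelOp]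
      _ ≤ _ := by
          rw [Finset.sum_range_succ']
          gcongr
          exact le_self_add

/-- Dini's theorem for antitone sequences of continuous `[0,∞]`-valued functions with limit zero. -/
theorem exists_forall_le_of_antitone_tendsto_zero {Y : Type*} [TopologicalSpace Y]
    {f : ℕ → Y → ℝ≥0∞} (hf : ∀ n, Continuous (f n)) (hanti : Antitone f)
    (hlim : ∀ y, Tendsto (fun n => f n y) atTop (𝓝 0)) {C : Set Y} (hC : IsCompact C)
    {ε : ℝ≥0∞} (hε : 0 < ε) : ∃ N, ∀ n ≥ N, ∀ y ∈ C, f n y ≤ ε := by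
  obtain ⟨N, hN⟩ := hC.elim_directed_cover (fun n => {y | f n y < ε})
    (fun n => isOpen_lt (hf n) continuous_const)
    (fun y _ => mem_iUnion.2 ((hlim y).eventually (gt_mem_nhds hε)).exists)
    (Monotone.directed_le fun m n hmn y hy => (hanti hmn y).trans_lt hy)
  exact ⟨N, fun n hn y hy => (hanti hn y).trans (hN hy).le⟩

variable [TopologicalSpace X] [OpensMeasurableSpace X]

theorem continuous_kernelOp (hκ : ∀ z, κ z univ ≤ 1)
    (hFeller : ∀ f : BoundedContinuousFunction X ℝ, Continuous fun z => ∫ w, f w ∂κ z)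
    {f : X → ℝ≥0∞} (hf : Continuous f) (hf1 : f ≤ 1) : Continuous (kernelOp κ f) := by
  have hne : ∀ w, f w ≠ ∞ := fun w => ((hf1 w).trans_lt ENNReal.one_lt_top).ne
  have hc : Continuous fun w => (f w).toReal :=
    ENNReal.continuousOn_toReal.comp_continuous hf hne
  have hb : ∀ w, (f w).toReal ≤ 1 := fun w => ENNReal.toReal_le_of_le_ofReal zero_le_one
    (by simpa using hf1 w)
  let g : BoundedContinuousFunction X ℝ := .ofNormedAddCommGroup _ hc 1 fun w => by
    rw [Real.norm_of_nonneg ENNReal.toReal_nonneg]; exact hb w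
  have e : kernelOp κ f = fun z => ENNReal.ofReal (∫ w, g w ∂κ z) := by
    funext z
    have : IsFiniteMeasure (κ z) := ⟨(hκ z).trans_lt ENNReal.one_lt_top⟩
    rw [ofReal_integral_eq_lintegral_ofReal (g.integrable _)
      (Eventually.of_forall fun w => ENNReal.toReal_nonneg)]
    exact lintegral_congr fun w => (ENNReal.ofReal_toReal (hne w)).symm
  rw [e]
  exact ENNReal.continuous_ofReal.comp (hFeller g)

theorem continuous_kernelOp_iterate (hκ : ∀ z, κ z univ ≤ 1)
    (hFeller : ∀ f : BoundedContinuousFunction X ℝ, Continuous fun z => ∫ w, f w ∂κ z)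
    {f : X → ℝ≥0∞} (hf : Continuous f) (hf1 : f ≤ 1) (n : ℕ) :
    Continuous ((kernelOp κ)^[n] f) := by
  induction n with
  | zero => exact hf
  | succ n ih =>
    rw [Function.iterate_succ_apply']
    exact continuous_kernelOp hκ hFeller ih (kernelOp_iterate_le_one hκ hf1 n)

/-- For a Feller sub-Markov kernel with `κ^n 1 → 0`, the excessive majorants of continuous functions
decreasing to zero tend to zero uniformly on compact sets: Dini's theorem applies first to `κ^N 1`
and then, for a fixed `N`, to the finite sums in the definition. -/
theorem exists_forall_excessiveMajorant_le (hκ : ∀ z, κ z univ ≤ 1)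
    (hFeller : ∀ f : BoundedContinuousFunction X ℝ, Continuous fun z => ∫ w, f w ∂κ z)
    (hext : ∀ z, Tendsto (fun n => (kernelOp κ)^[n] 1 z) atTop (𝓝 0))
    {φ : ℕ → X → ℝ≥0∞} (hφ : ∀ n, Continuous (φ n)) (hφ1 : ∀ n, φ n ≤ 1) (hanti : Antitone φ)
    (hlim : ∀ z, Tendsto (fun n => φ n z) atTop (𝓝 0)) {C : Set X} (hC : IsCompact C)
    {ε : ℝ≥0∞} (hε : 0 < ε) : ∃ N, ∀ n ≥ N, ∀ z ∈ C, excessiveMajorant κ (φ n) z ≤ ε := by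
  have hε2 : 0 < ε / 2 := ENNReal.half_pos hε.ne'
  obtain ⟨M, hM⟩ := exists_forall_le_of_antitone_tendsto_zero
    (fun n => continuous_kernelOp_iterate hκ hFeller continuous_one le_rfl n)
    (antitone_kernelOp_iterate_one hκ) hext hC hε2
  obtain ⟨N, hN⟩ := exists_forall_le_of_antitone_tendsto_zero
    (f := fun n z => ∑ k ∈ Finset.range M, (kernelOp κ)^[k] (φ n) z)
    (fun n => continuous_finsetSum _ fun k _ =>
      continuous_kernelOp_iterate hκ hFeller (hφ n) (hφ1 n) k)
    (fun m n hmn z => Finset.sum_le_sum fun k _ => kernelOp_mono.iterate k (hanti hmn) z)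
    (fun z => by
      simpa using tendsto_finsetSum (Finset.range M) fun k _ =>
        tendsto_kernelOp_iterate_zero hκ (fun n => (hφ n).measurable) hφ1 hlim k z)
    hC hε2
  refine ⟨N, fun n hn z hz => (iInf_le _ M).trans ?_⟩
  rw [← ENNReal.add_halves ε]
  exact add_le_add (hN n hn z hz) (hM M le_rfl z hz)

/-- The converse of the Lyapunov criterion for Feller sub-Markov kernels. The test function is a sum
of excessive majorants of cutoff functions that vanish on larger and larger compact sets. -/
theorem exists_excessive_of_tendsto [NormalSpace X] (hκ : ∀ z, κ z univ ≤ 1)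
    (hFeller : ∀ f : BoundedContinuousFunction X ℝ, Continuous fun z => ∫ w, f w ∂κ z)
    (hext : ∀ z, Tendsto (fun n => (kernelOp κ)^[n] 1 z) atTop (𝓝 0))
    {C : ℕ → Set X} (hC : ∀ n, IsCompact (C n)) (hCc : ∀ n, IsClosed (C n))
    (hint : ∀ n, C n ⊆ interior (C (n + 1))) (hU : ⋃ n, C n = univ) :
    ∃ V : X → ℝ≥0, Measurable V ∧
      (kernelOp κ (fun z => (V z : ℝ≥0∞)) ≤ fun z => (V z : ℝ≥0∞)) ∧
      Tendsto (fun n => ⨅ z ∈ (C n)ᶜ, (V z : ℝ≥0∞)) atTop (𝓝 ∞) ∧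
      ∀ n, ∃ B : ℝ≥0, ∀ z ∈ C n, V z ≤ B := by
  have hmono : Monotone C := monotone_nat_of_le_succ fun n => (hint n).trans interior_subset
  have hur : ∀ n, ∃ f : C(X, ℝ), EqOn f 0 (C n) ∧ EqOn f 1 (interior (C (n + 1)))ᶜ ∧
      ∀ x, f x ∈ Icc (0 : ℝ) 1 := fun n =>
    exists_continuous_zero_one_of_isClosed (hCc n) isOpen_interior.isClosed_compl
      (disjoint_compl_right_iff_subset.2 (hint n))
  choose g hg0 hg1 hg using hur
  set φ : ℕ → X → ℝ≥0∞ := fun n z => ENNReal.ofReal (g n z) with hφdef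
  have hφ : ∀ n, Continuous (φ n) := fun n => ENNReal.continuous_ofReal.comp (g n).continuous
  have hφ1 : ∀ n, φ n ≤ 1 := fun n z => by
    simpa [hφdef] using (hg n z).2
  have hone : ∀ n, ∀ z ∉ C (n + 1), φ n z = 1 := fun n z hz => by
    simp [hφdef, hg1 n (show z ∈ (interior (C (n + 1)))ᶜ from fun h => hz (interior_subset h))]
  have hzero : ∀ n, ∀ z ∈ C n, φ n z = 0 := fun n z hz => by
    simp [hφdef, hg0 n hz]
  have hanti : Antitone φ := antitone_nat_of_succ_le fun n z => by
    by_cases hz : z ∈ C (n + 1)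
    · rw [hzero _ z hz]; exact zero_le
    · rw [hone _ z hz]; exact hφ1 _ z
  have hmem : ∀ z, ∃ n, z ∈ C n := fun z => mem_iUnion.1 (hU ▸ mem_univ z)
  have hlim : ∀ z, Tendsto (fun n => φ n z) atTop (𝓝 0) := by
    intro z
    obtain ⟨m, hm⟩ := hmem z
    refine tendsto_const_nhds.congr' ?_
    filter_upwards [eventually_ge_atTop m] with n hn
    exact (hzero n z (hmono hn hm)).symm
  have hchoose : ∀ k : ℕ, ∃ n, ∀ z ∈ C k, excessiveMajorant κ (φ n) z ≤ (2⁻¹ : ℝ≥0∞) ^ k := by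
    intro k
    obtain ⟨N, hN⟩ := exists_forall_excessiveMajorant_le hκ hFeller hext hφ hφ1 hanti hlim (hC k)
      (ε := (2⁻¹ : ℝ≥0∞) ^ k) (ENNReal.pow_pos (ENNReal.inv_pos.2 (by finiteness)) k)
    exact ⟨N, hN N le_rfl⟩
  choose s hs using hchoose
  set r : ℕ → X → ℝ≥0∞ := fun k => excessiveMajorant κ (φ (s k)) with hr
  have hrm : ∀ k, Measurable (r k) := fun k => measurable_excessiveMajorant (hφ _).measurable
  have hbound : ∀ m, ∀ z ∈ C m, ∑' k, r k z ≤ m + 2 := by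
    intro m z hz
    calc ∑' k, r k z ≤ ∑' k, ((if k ∈ Finset.range m then 1 else 0) + 2⁻¹ ^ k) := by
          refine ENNReal.tsum_le_tsum fun k => ?_
          split_ifs with hk
          · exact le_add_right (excessiveMajorant_le_one _ z)
          · refine le_add_left (hs k z (hmono ?_ hz))
            simpa using hk
      _ = m + 2 := by
          rw [ENNReal.tsum_add, ENNReal.tsum_geometric, ENNReal.one_sub_inv_two, inv_inv,
            tsum_eq_sum (s := Finset.range m) fun k hk => if_neg hk,
            Finset.sum_congr rfl fun k hk => if_pos hk]
          simp
  have hfin : ∀ z, ∑' k, r k z ≠ ∞ := fun z => by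
    obtain ⟨m, hm⟩ := hmem z
    exact ((hbound m z hm).trans_lt (by finiteness)).ne
  have hcoe : ∀ z, (((∑' k, r k z).toNNReal : ℝ≥0) : ℝ≥0∞) = ∑' k, r k z := fun z =>
    ENNReal.coe_toNNReal (hfin z)
  refine ⟨fun z => (∑' k, r k z).toNNReal, (Measurable.tsum hrm).ennreal_toNNReal,
    ?_, ?_, fun n => ⟨n + 2, fun z hz => ?_⟩⟩
  · simp only [hcoe]
    intro z
    simp only [kernelOp]
    rw [lintegral_tsum fun k => (hrm k).aemeasurable]
    exact ENNReal.tsum_le_tsum fun k => kernelOp_excessiveMajorant_le hκ (hφ _).measurable z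
  · simp only [hcoe]
    rw [ENNReal.tendsto_nhds_top_iff_nat]
    intro j
    -- Off `C n`, the first `j + 1` terms of the series are equal to one.
    filter_upwards [eventually_ge_atTop ((Finset.range (j + 1)).sup s + 1)] with n hn
    refine lt_of_lt_of_le (b := ((j + 1 : ℕ) : ℝ≥0∞)) (by exact_mod_cast j.lt_succ_self)
      (le_iInf₂ fun z hz => ?_)
    refine le_trans ?_ (ENNReal.sum_le_tsum (Finset.range (j + 1)))
    calc ((j + 1 : ℕ) : ℝ≥0∞) = ∑ k ∈ Finset.range (j + 1), 1 := by simp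
      _ ≤ _ := Finset.sum_le_sum fun k hk => by
        have h1 : s k + 1 ≤ n := (Nat.add_le_add_right (Finset.le_sup hk) 1).trans hn
        rw [← hone (s k) z fun h => hz (hmono h1 h)]
        exact le_excessiveMajorant (hφ1 _) z
  · rw [← ENNReal.coe_le_coe, hcoe]
    exact_mod_cast hbound n z hz

end KernelOp

namespace QFunction

/-! ### Discounted functions of jump moment and state -/

variable {S : Type*}

/-- The function `e^{-α t} f(t, x)`, extended by zero to the cemetery. -/
noncomputable def discounted (α : ℝ≥0) (f : ℝ≥0 × S → ℝ≥0∞) : (ℝ≥0 × S) ⊕ Unit → ℝ≥0∞ :=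
  Sum.elim (fun z => ENNReal.ofReal (Real.exp (-(α * z.1))) * f z) 0

theorem discounted_one_le (α : ℝ≥0) (y : (ℝ≥0 × S) ⊕ Unit) : discounted α 1 y ≤ 1 := by
  rcases y with z | u
  · simp [discounted, mul_nonneg]
  · simp [discounted]

variable [MeasurableSpace S]

theorem measurable_discounted (α : ℝ≥0) {f : ℝ≥0 × S → ℝ≥0∞} (hf : Measurable f) :
    Measurable (discounted α f) :=
  Measurable.sumElim (by fun_prop) measurable_const

theorem measurable_jumpMoment : Measurable (jumpMoment (S := S)) :=
  Measurable.sumElim (by fun_prop) measurable_const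

variable [MeasurableEq S]

/-! ### Survival probabilities and the discounted jump kernel -/

theorem intervalIntegrable_rate (q : QFunction S) (x : S) (v : ℝ≥0) (a b : ℝ) :
    IntervalIntegrable (fun s : ℝ => q.rate x (v + s.toNNReal)) volume a b := by
  obtain ⟨C, hC⟩ := q.stable x
  have hg : Measurable fun s : ℝ => q.rate x (v + s.toNNReal) :=
    q.measurable_rate.comp (f := fun s : ℝ => (x, v + s.toNNReal)) (by fun_prop)
  refine (intervalIntegrable_const (c := C)).mono_fun hg.aestronglyMeasurable ?_
  refine Eventually.of_forall fun r => ?_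
  have : q.rate x (v + r.toNNReal) ≤ C := by rw [rate_eq]; exact hC ⟨_, rfl⟩
  change ‖q.rate x (v + r.toNNReal)‖ ≤ ‖C‖
  rw [Real.norm_of_nonneg (q.rate_nonneg _ _)]
  exact this.trans (le_abs_self C)

/-- Where the rate is at most `C`, the next jump occurs before an independent exponential time of
rate `α` with probability at most `C / (C + α)`. -/
theorem jumpKernel_univ_le_div (q : QFunction S) {α : ℝ≥0} (hα : 0 < α) (v : ℝ≥0) {x : S} {C : ℝ}
    (hC : ∀ t : ℝ≥0, q.rate x t ≤ C) :
    q.jumpKernel α (v, x) univ ≤ ENNReal.ofReal (C / (C + α)) := by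
  have hα' : (0 : ℝ) < α := hα
  have hC0 : 0 ≤ C := (q.rate_nonneg x 0).trans (hC 0)
  have hg : Measurable fun s : ℝ => q.rate x (v + s.toNNReal) :=
    q.measurable_rate.comp (f := fun s : ℝ => (x, v + s.toNNReal)) (by fun_prop)
  have hz := lintegral_hazard_le_one (fun s => α + q.rate x (v + s.toNNReal))
    (measurable_const.add hg) (fun r => add_nonneg α.2 (q.rate_nonneg _ _)) (α + C)
    fun r => by gcongr; exact hC _
  rw [← lintegral_one, lintegral_jumpKernel _ _ _ _ measurable_const]
  simp only [one_mul, lintegral_const, jumpRate_univ]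
  refine le_trans ?_ ((mul_le_mul_right hz (ENNReal.ofReal (C / (C + α)))).trans_eq (mul_one _))
  rw [← lintegral_const_mul' _ _ ENNReal.ofReal_ne_top]
  refine lintegral_mono fun t => ?_
  have e : survival q α (v, x) t =
      Real.exp (-∫ s in (0 : ℝ)..t, ((α : ℝ) + q.rate x (v + s.toNNReal))) := by
    rw [intervalIntegral.integral_add intervalIntegrable_const
      (q.intervalIntegrable_rate x v _ _), intervalIntegral.integral_const, survival]
    congr 1
    simp only [smul_eq_mul]
    ring
  rw [e, mul_left_comm, ← ENNReal.ofReal_mul (p := C / (C + α)) (by positivity)]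
  gcongr
  have h0 := hC (v + t.toNNReal)
  rw [div_mul_eq_mul_div, le_div_iff₀ (by linarith)]
  nlinarith

theorem survival_add (q : QFunction S) (α : ℝ≥0) (u v : ℝ≥0) (x : S) {s : ℝ} (hs : 0 ≤ s) :
    q.survival α (u, x) (v + s) = q.survival α (u, x) v * q.survival α (u + v, x) s := by
  have hi := q.intervalIntegrable_rate x u
  have e : ∫ r in (0 : ℝ)..s, q.rate x (u + v + r.toNNReal) =
      ∫ r in (v : ℝ)..v + s, q.rate x (u + r.toNNReal) := by
    rw [← add_zero (v : ℝ), add_assoc, zero_add,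
      ← intervalIntegral.integral_comp_add_left (fun r : ℝ => q.rate x (u + r.toNNReal))]
    refine intervalIntegral.integral_congr fun r hr => ?_
    rw [uIcc_of_le hs] at hr
    rw [Real.toNNReal_add v.coe_nonneg hr.1, Real.toNNReal_coe, add_assoc]
  simp only [survival]
  rw [e, ← Real.exp_add, ← intervalIntegral.integral_add_adjacent_intervals (hi 0 v) (hi v (v + s))]
  congr 1
  ring

/-- On the event that no jump and no discounting occur during a time `v`, the chain restarts from
the same state at time `u + v`. -/
theorem survival_mul_kernelOp_le (q : QFunction S) (α : ℝ≥0) (u v : ℝ≥0) (x : S)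
    {f : ℝ≥0 × S → ℝ≥0∞} (hf : Measurable f) :
    ENNReal.ofReal (q.survival α (u, x) v) * kernelOp (q.jumpKernel α) f (u + v, x) ≤
      kernelOp (q.jumpKernel α) f (u, x) := by
  simp only [kernelOp]
  rw [lintegral_jumpKernel _ _ _ _ hf, lintegral_jumpKernel _ _ _ _ hf,
    ← lintegral_const_mul' _ _ ENNReal.ofReal_ne_top]
  set F : ℝ → ℝ≥0∞ := fun t => ∫⁻ y, f (u + t.toNNReal, y) *
    ENNReal.ofReal (q.survival α (u, x) t) ∂q.jumpRate (x, u + t.toNNReal) with hF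
  calc _ = ∫⁻ t in Ioi (0 : ℝ), F (v + t) := by
        refine setLIntegral_congr_fun measurableSet_Ioi fun t ht => ?_
        have ht : 0 ≤ t := le_of_lt ht
        simp only [hF]
        rw [q.survival_add α u v x ht, Real.toNNReal_add v.coe_nonneg ht, Real.toNNReal_coe, ← add_assoc,
          ← lintegral_const_mul' _ _ ENNReal.ofReal_ne_top,
          ENNReal.ofReal_mul (p := q.survival α (u, x) v) (Real.exp_nonneg _)]
        exact lintegral_congr fun y => by ring
    _ = ∫⁻ t, (Ioi (v : ℝ)).indicator F (v + t) := by
        rw [← lintegral_indicator measurableSet_Ioi]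
        refine lintegral_congr fun t => ?_
        simp [indicator_apply]
    _ = ∫⁻ t in Ioi (v : ℝ), F t := by
        rw [lintegral_add_left_eq_self, lintegral_indicator measurableSet_Ioi]
    _ ≤ ∫⁻ t in Ioi (0 : ℝ), F t := lintegral_mono_set (Ioi_subset_Ioi v.2)

/-! ### The embedded chain -/

theorem lintegral_chainKernel_inl (q : QFunction S) (α : ℝ≥0) (z : ℝ≥0 × S)
    {F : (ℝ≥0 × S) ⊕ Unit → ℝ≥0∞} (hF : Measurable F) :
    ∫⁻ w, F w ∂q.chainKernel α (Sum.inl z) =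
      ∫⁻ w, F (Sum.inl w) ∂q.jumpKernel α z +
        (1 - q.jumpKernel α z univ) * F (Sum.inr ()) := by
  change ∫⁻ w, F w ∂((q.jumpKernel α z).map Sum.inl +
    (1 - q.jumpKernel α z univ) • Measure.dirac (Sum.inr ())) = _
  rw [lintegral_add_measure, lintegral_map hF measurable_inl, lintegral_smul_measure,
    lintegral_dirac' _ hF, smul_eq_mul]

theorem lintegral_chainKernel_inr (q : QFunction S) (α : ℝ≥0) (u : Unit)
    {F : (ℝ≥0 × S) ⊕ Unit → ℝ≥0∞} (hF : Measurable F) :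
    ∫⁻ w, F w ∂q.chainKernel α (Sum.inr u) = F (Sum.inr u) :=
  lintegral_dirac' _ hF

/-- The undiscounted chain acts on discounted functions as the discounted kernel. -/
theorem lintegral_discounted (q : QFunction S) (α : ℝ≥0) {f : ℝ≥0 × S → ℝ≥0∞} (hf : Measurable f)
    (y : (ℝ≥0 × S) ⊕ Unit) :
    ∫⁻ w, discounted α f w ∂q.chainKernel 0 y =
      discounted α (kernelOp (q.jumpKernel α) f) y := by
  rcases y with ⟨v, x⟩ | u
  · rw [lintegral_chainKernel_inl _ _ _ (measurable_discounted α hf)]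
    simp only [discounted, Sum.elim_inl, Sum.elim_inr, Pi.zero_apply, mul_zero, add_zero, kernelOp]
    rw [lintegral_jumpKernel _ _ _ _ (by fun_prop), lintegral_jumpKernel _ _ _ _ hf,
      ← lintegral_const_mul' _ _ ENNReal.ofReal_ne_top]
    refine setLIntegral_congr_fun measurableSet_Ioi fun t ht => ?_
    have ht : 0 ≤ t := le_of_lt ht
    simp only
    rw [← lintegral_const_mul' _ _ ENNReal.ofReal_ne_top]
    refine lintegral_congr fun y => ?_
    have e : Real.exp (-(α * ((v + t.toNNReal : ℝ≥0) : ℝ))) * q.survival 0 (v, x) t =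
        Real.exp (-(α * v)) * q.survival α (v, x) t := by
      simp only [survival]
      rw [← Real.exp_add, ← Real.exp_add, NNReal.coe_add, Real.coe_toNNReal t ht]
      congr 1
      push_cast
      ring
    calc _ = f (v + t.toNNReal, y) *
          (ENNReal.ofReal (Real.exp (-(α * ((v + t.toNNReal : ℝ≥0) : ℝ)))) *
            ENNReal.ofReal (q.survival 0 (v, x) t)) := by ring
      _ = f (v + t.toNNReal, y) * (ENNReal.ofReal (Real.exp (-(α * v))) *
            ENNReal.ofReal (q.survival α (v, x) t)) := by
          rw [← ENNReal.ofReal_mul (Real.exp_nonneg _), e, ENNReal.ofReal_mul (Real.exp_nonneg _)]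
      _ = _ := by ring
  · rw [lintegral_chainKernel_inr _ _ _ (measurable_discounted α hf)]
    rfl

instance (q : QFunction S) (x : S) : IsProbabilityMeasure (q.pathLaw x) := by
  unfold pathLaw
  infer_instance

theorem lintegral_pathLaw_zero (q : QFunction S) (x : S) {F : (ℝ≥0 × S) ⊕ Unit → ℝ≥0∞}
    (hF : Measurable F) : ∫⁻ ω, F (ω 0) ∂q.pathLaw x = F (Sum.inl (0, x)) := by
  have hm : Measurable fun p : (Finset.Iic 0 → (ℝ≥0 × S) ⊕ Unit) =>
      F (p ⟨0, Finset.mem_Iic.2 le_rfl⟩) := hF.comp (measurable_pi_apply _)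
  have h := lintegral_map (μ := q.pathLaw x) hm
    (Preorder.measurable_frestrictLe (X := fun _ : ℕ => (ℝ≥0 × S) ⊕ Unit) 0)
  unfold pathLaw at h ⊢
  rw [Kernel.traj_map_frestrictLe_apply, Kernel.partialTraj_self, Kernel.id_apply,
    lintegral_dirac' _ hm] at h
  exact h.symm

/-- The Markov property of `(t_n, x_n)` for functions of two consecutive states. -/
theorem lintegral_pathLaw_succ (q : QFunction S) (x : S) (n : ℕ)
    {G : (ℝ≥0 × S) ⊕ Unit → (ℝ≥0 × S) ⊕ Unit → ℝ≥0∞} (hG : Measurable (Function.uncurry G)) :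
    ∫⁻ ω, G (ω n) (ω (n + 1)) ∂q.pathLaw x =
      ∫⁻ ω, ∫⁻ w, G (ω n) w ∂q.chainKernel 0 (ω n) ∂q.pathLaw x := by
  have hm : Measurable fun p : (Finset.Iic (n + 1) → (ℝ≥0 × S) ⊕ Unit) =>
      G (p ⟨n, Finset.mem_Iic.2 n.le_succ⟩) (p ⟨n + 1, Finset.mem_Iic.2 le_rfl⟩) :=
    Measurable.comp (g := Function.uncurry G) (f := fun p : (Finset.Iic (n + 1) → _) =>
      (p ⟨n, Finset.mem_Iic.2 n.le_succ⟩, p ⟨n + 1, Finset.mem_Iic.2 le_rfl⟩)) hG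
      ((measurable_pi_apply _).prodMk (measurable_pi_apply _))
  have hm2 : Measurable fun y : (ℝ≥0 × S) ⊕ Unit => ∫⁻ w, G y w ∂q.chainKernel 0 y :=
    hG.lintegral_kernel_prod_right'
  have hm1 : Measurable fun p : (Finset.Iic n → (ℝ≥0 × S) ⊕ Unit) =>
      ∫⁻ w, G (p ⟨n, Finset.mem_Iic.2 le_rfl⟩) w
        ∂q.chainKernel 0 (p ⟨n, Finset.mem_Iic.2 le_rfl⟩) := hm2.comp (measurable_pi_apply _)
  have h := lintegral_map (μ := q.pathLaw x) hm
    (Preorder.measurable_frestrictLe (X := fun _ : ℕ => (ℝ≥0 × S) ⊕ Unit) (n + 1))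
  have h1 := lintegral_map (μ := q.pathLaw x) hm1
    (Preorder.measurable_frestrictLe (X := fun _ : ℕ => (ℝ≥0 × S) ⊕ Unit) n)
  refine (h.symm.trans ?_).trans h1
  unfold pathLaw
  rw [Kernel.traj_map_frestrictLe_apply, Kernel.traj_map_frestrictLe_apply,
    Kernel.partialTraj_succ_eq_comp (Nat.zero_le n), Kernel.lintegral_comp _ _ _ hm]
  refine lintegral_congr fun p => ?_
  have hI := measurable_IicProdIoc (X := fun _ : ℕ => (ℝ≥0 × S) ⊕ Unit) (m := n) (n := n + 1)
  rw [Kernel.partialTraj_succ_self]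
  refine (Kernel.lintegral_map _ hI p hm).trans ?_
  refine (Kernel.lintegral_id_prod (hm.comp hI) _ p).trans ?_
  refine (Kernel.lintegral_map _ (MeasurableEquiv.measurable _) p
    ((hm.comp hI).comp measurable_prodMk_left)).trans ?_
  rw [Kernel.comap_apply]
  refine lintegral_congr fun w => ?_
  simp [IicProdIoc_def, MeasurableEquiv.piSingleton]

/-- The expectation of `e^{-α t_n}` is the total mass of the `n`-th power of the discounted
kernel. -/
theorem lintegral_pathLaw_discounted (q : QFunction S) (α : ℝ≥0) (x : S) (n : ℕ) :
    ∫⁻ ω, discounted α 1 (ω n) ∂q.pathLaw x = (kernelOp (q.jumpKernel α))^[n] 1 (0, x) := by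
  have h : ∀ n (f : ℝ≥0 × S → ℝ≥0∞), Measurable f →
      ∫⁻ ω, discounted α f (ω n) ∂q.pathLaw x = (kernelOp (q.jumpKernel α))^[n] f (0, x) := by
    intro n
    induction n with
    | zero =>
      intro f hf
      rw [lintegral_pathLaw_zero _ _ (measurable_discounted α hf)]
      simp [discounted]
    | succ n ih =>
      intro f hf
      rw [q.lintegral_pathLaw_succ x n (G := fun _ w => discounted α f w)
        ((measurable_discounted α hf).comp measurable_snd), Function.iterate_succ_apply,
        ← ih _ (measurable_kernelOp hf)]
      exact lintegral_congr fun ω => q.lintegral_discounted α hf _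
  exact h n 1 measurable_one

theorem ae_jumpMoment_le_succ (q : QFunction S) (x : S) :
    ∀ᵐ ω ∂q.pathLaw x, ∀ n, jumpMoment (ω n) ≤ jumpMoment (ω (n + 1)) := by
  rw [ae_all_iff]
  intro n
  have hD : MeasurableSet {p : ((ℝ≥0 × S) ⊕ Unit) × ((ℝ≥0 × S) ⊕ Unit) |
      jumpMoment p.2 < jumpMoment p.1} :=
    measurableSet_lt (measurable_jumpMoment.comp measurable_snd)
      (measurable_jumpMoment.comp measurable_fst)
  set G : (ℝ≥0 × S) ⊕ Unit → (ℝ≥0 × S) ⊕ Unit → ℝ≥0∞ := fun y w =>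
    {p : ((ℝ≥0 × S) ⊕ Unit) × ((ℝ≥0 × S) ⊕ Unit) |
      jumpMoment p.2 < jumpMoment p.1}.indicator 1 (y, w) with hGdef
  have hG : Measurable (Function.uncurry G) := measurable_one.indicator hD
  have hGy : ∀ y, Measurable (G y) := fun y => hG.comp measurable_prodMk_left
  have h0 : ∀ y, ∫⁻ w, G y w ∂q.chainKernel 0 y = 0 := by
    rintro (⟨v, z⟩ | u)
    · rw [lintegral_chainKernel_inl _ _ _ (hGy _), lintegral_jumpKernel
        (f := fun w => G (Sum.inl (v, z)) (Sum.inl w)) _ _ _ _ ((hGy _).comp measurable_inl)]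
      have h1 : ∀ (t : ℝ≥0) (y : S), G (Sum.inl (v, z)) (Sum.inl (v + t, y)) = 0 := by
        intro t y
        simp [hGdef, jumpMoment]
      simp only [h1, zero_mul, lintegral_zero, zero_add]
      simp [hGdef, jumpMoment]
    · rw [lintegral_chainKernel_inr _ _ _ (hGy _)]
      simp [hGdef]
  have h := q.lintegral_pathLaw_succ x n hG
  simp only [h0, lintegral_zero] at h
  have hGn : Measurable fun ω : ℕ → (ℝ≥0 × S) ⊕ Unit => G (ω n) (ω (n + 1)) :=
    Measurable.comp (g := Function.uncurry G) (f := fun ω : ℕ → (ℝ≥0 × S) ⊕ Unit =>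
      (ω n, ω (n + 1))) hG ((measurable_pi_apply n).prodMk (measurable_pi_apply (n + 1)))
  rw [lintegral_eq_zero_iff hGn] at h
  filter_upwards [h] with ω hω
  by_contra hlt
  simp [hGdef, not_le.1 hlt] at hω

/-- Nonexplosion is the extinction of the discounted chain, since `E e^{-α t_n}` tends to
`E e^{-α t_∞}`. -/
theorem nonexplosive_iff_tendsto (q : QFunction S) {α : ℝ≥0} (hα : 0 < α) :
    q.Nonexplosive ↔
      ∀ x, Tendsto (fun n => (kernelOp (q.jumpKernel α))^[n] 1 (0, x)) atTop (𝓝 0) := by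
  refine forall_congr' fun x => ?_
  have hα' : (0 : ℝ) < α := hα
  have hmd : ∀ n, Measurable fun ω : ℕ → (ℝ≥0 × S) ⊕ Unit => discounted α 1 (ω n) := fun n =>
    (measurable_discounted α measurable_one).comp (measurable_pi_apply n)
  have hms : MeasurableSet {ω : ℕ → (ℝ≥0 × S) ⊕ Unit | ⨆ n, jumpMoment (ω n) = ∞} :=
    (Measurable.iSup fun n => measurable_jumpMoment.comp (measurable_pi_apply n))
      (measurableSet_singleton ∞)
  rw [← mem_ae_iff_prob_eq_one hms]
  simp only [← q.lintegral_pathLaw_discounted α x]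
  constructor
  · intro h
    have hlim : ∀ᵐ ω ∂q.pathLaw x, Tendsto (fun n => discounted α 1 (ω n)) atTop (𝓝 0) := by
      filter_upwards [h, q.ae_jumpMoment_le_succ x] with ω hω hmono
      have ht : Tendsto (fun n => jumpMoment (ω n)) atTop (𝓝 ∞) := by
        have := tendsto_atTop_iSup (monotone_nat_of_le_succ hmono)
        rwa [show ⨆ n, jumpMoment (ω n) = ∞ from hω] at this
      rw [ENNReal.tendsto_nhds_zero]
      intro ε hε
      have he : Tendsto (fun t : ℝ => ENNReal.ofReal (Real.exp (-(α * t)))) atTop (𝓝 0) := by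
        rw [← ENNReal.ofReal_zero]
        exact ENNReal.tendsto_ofReal (Real.tendsto_exp_neg_atTop_nhds_zero.comp
          (tendsto_id.const_mul_atTop hα'))
      obtain ⟨T, hT⟩ := eventually_atTop.1 (ENNReal.tendsto_nhds_zero.1 he ε hε)
      filter_upwards [ht.eventually (lt_mem_nhds (show (T.toNNReal : ℝ≥0∞) < ∞ by simp))]
        with n hn
      rcases hy : ω n with z | u
      · rw [hy] at hn
        have h1 : T.toNNReal < z.1 := by simpa [jumpMoment] using hn
        simpa [discounted] using hT z.1 ((Real.le_coe_toNNReal T).trans (by exact_mod_cast h1.le))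
      · simp [discounted]
    have h2 := tendsto_lintegral_of_dominated_convergence (μ := q.pathLaw x)
      (F := fun n ω => discounted α 1 (ω n)) (f := fun _ => 0) 1 hmd
      (fun n => Eventually.of_forall fun ω => discounted_one_le α _) (by simp) hlim
    simpa only [lintegral_zero] using h2
  · intro h
    have h0 : ∫⁻ ω, ⨅ n, discounted α 1 (ω n) ∂q.pathLaw x = 0 :=
      le_antisymm (ge_of_tendsto' h fun n => lintegral_mono fun ω => iInf_le _ n) zero_le
    rw [lintegral_eq_zero_iff (Measurable.iInf hmd)] at h0
    filter_upwards [h0] with ω hω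
    by_contra hne
    -- If the jump moments are bounded by `T`, the discount factors are at least `e^{-α T} > 0`.
    have hne' : ⨆ n, jumpMoment (ω n) ≠ ∞ := hne
    have hle : ENNReal.ofReal (Real.exp (-(α * (⨆ n, jumpMoment (ω n)).toReal))) ≤
        ⨅ n, discounted α 1 (ω n) := by
      refine le_iInf fun n => ?_
      have hn : jumpMoment (ω n) ≤ ⨆ n, jumpMoment (ω n) := le_iSup (fun n => jumpMoment (ω n)) n
      rcases hy : ω n with z | u
      · rw [hy] at hn
        have h1 : (z.1 : ℝ) ≤ (⨆ n, jumpMoment (ω n)).toReal := by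
          have := ENNReal.toReal_mono hne' hn
          simpa [jumpMoment] using this
        simp only [discounted, Sum.elim_inl, Pi.one_apply, mul_one]
        gcongr
      · rw [hy] at hn
        exact absurd (top_le_iff.1 hn) hne'
    rw [show ⨅ n, discounted α 1 (ω n) = 0 from hω, nonpos_iff_eq_zero,
      ENNReal.ofReal_eq_zero] at hle
    exact absurd hle (not_le.2 (Real.exp_pos _))

/-- If the process is nonexplosive from time `0`, the discounted chain dies out from every time `v`:
started from `x` at time `0`, the process is still in `x` at time `v` with positive probability. -/
theorem Nonexplosive.tendsto (q : QFunction S) {α : ℝ≥0} (hα : 0 < α) (h : q.Nonexplosive)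
    (z : ℝ≥0 × S) :
    Tendsto (fun n => (kernelOp (q.jumpKernel α))^[n] 1 z) atTop (𝓝 0) := by
  obtain ⟨v, x⟩ := z
  have h0 := (q.nonexplosive_iff_tendsto hα).1 h x
  have hs : ENNReal.ofReal (q.survival α (0, x) v) ≠ 0 := by
    simpa [survival] using Real.exp_pos _
  rw [← tendsto_add_atTop_iff_nat 1] at h0 ⊢
  have h1 := ENNReal.Tendsto.const_mul (a := (ENNReal.ofReal (q.survival α (0, x) v))⁻¹) h0
    (Or.inr (ENNReal.inv_ne_top.2 hs))
  rw [mul_zero] at h1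
  refine tendsto_of_tendsto_of_tendsto_of_le_of_le tendsto_const_nhds h1 (fun _ => zero_le)
    fun n => ?_
  have h2 := q.survival_mul_kernelOp_le α 0 v x (f := (kernelOp (q.jumpKernel α))^[n] 1)
    (measurable_kernelOp_iterate measurable_one n)
  rw [zero_add] at h2
  simp only [Function.iterate_succ_apply']
  rw [mul_comm, ← div_eq_mul_inv, ENNReal.le_div_iff_mul_le (Or.inl hs)
    (Or.inl ENNReal.ofReal_ne_top), mul_comm]
  exact h2

/-! ### The drift condition -/

/-- The integral drift inequality says that `V` is excessive for the discounted kernel. -/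
theorem kernelOp_le_iff_drift (q : QFunction S) (α : ℝ≥0) {V : ℝ≥0 × S → ℝ≥0} (hV : Measurable V) :
    (kernelOp (q.jumpKernel α) (fun z => (V z : ℝ≥0∞)) ≤ fun z => (V z : ℝ≥0∞)) ↔
      ∀ (v : ℝ≥0) (x : S), ∫⁻ t in Ioi (0 : ℝ), ∫⁻ y, V (v + t.toNNReal, y) *
        ENNReal.ofReal (Real.exp (-(α * t) - ∫ s in (0 : ℝ)..t, q.rate x (v + s.toNNReal)))
      ∂q.jumpRate (x, v + t.toNNReal) ≤ V (v, x) := by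
  rw [Pi.le_def, Prod.forall]
  refine forall₂_congr fun v x => ?_
  rw [kernelOp, lintegral_jumpKernel _ _ _ _ hV.coe_nnreal_ennreal]
  rfl

theorem Drift.nonexplosive {q : QFunction S} {α : ℝ≥0} (hα : 0 < α) {St : ℕ → Set (ℝ≥0 × S)}
    {V : ℝ≥0 × S → ℝ≥0} (h : q.Drift α St V) : q.Nonexplosive := by
  have hα' : (0 : ℝ) < α := hα
  rw [q.nonexplosive_iff_tendsto hα]
  refine fun x => tendsto_kernelOp_iterate_one (q.jumpKernel_univ_le_one α) h.measurable
    ((q.kernelOp_le_iff_drift α h.measurable).2 h.drift) (fun n => ?_) h.tendsto_iInf (0, x)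
  obtain ⟨C, hC⟩ := h.rate_bounded n
  refine ⟨ENNReal.ofReal (|C| / (|C| + α)), ?_, fun z hz => ?_⟩
  · rw [ENNReal.ofReal_lt_one, div_lt_one (by positivity)]
    linarith
  · exact q.jumpKernel_univ_le_div hα z.1 fun t => (hC z.2 ⟨z, hz, rfl⟩ t).trans (le_abs_self C)

end QFunction

theorem theorem3p2 {S : Type*} [MeasurableSpace S] [StandardBorelSpace S] [Nonempty S]
    (q : QFunction S) :
    (q.DriftCondition → q.Nonexplosive) ∧
    (∀ [MetricSpace S] [LocallyCompactSpace S] [TopologicalSpace.SeparableSpace S] [BorelSpace S]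
      (α : ℝ≥0), 0 < α →
      (∀ Γ : Set S, IsCompact Γ → ∃ C : ℝ, ∀ x ∈ Γ, ∀ t : ℝ≥0, q.rate x t ≤ C) →
      q.WeaklyFeller α →
      q.Nonexplosive →
      ∃ (T : ℕ → Set ℝ≥0) (K : ℕ → Set S) (V : ℝ≥0 × S → ℝ≥0),
        (∀ n, IsCompact (T n)) ∧ (∀ n, IsCompact (K n)) ∧
        q.Drift α (fun n => T n ×ˢ K n) V ∧
        ∀ n, ∃ C : ℝ≥0, ∀ z ∈ T n ×ˢ K n, V z ≤ C) := by
  refine ⟨fun ⟨α, hα, St, V, h⟩ => h.nonexplosive hα, ?_⟩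
  intro _ _ _ _ α hα hrate hFeller hne
  have : SecondCountableTopology S := UniformSpace.secondCountable_of_separable S
  let K : CompactExhaustion S := default
  let T : ℕ → Set ℝ≥0 := fun n => Icc 0 n
  have hT : ∀ n, T n ⊆ interior (T (n + 1)) := fun n =>
    (show T n ⊆ Iio ((n + 1 : ℕ) : ℝ≥0) from fun t ht =>
      ht.2.trans_lt (by exact_mod_cast n.lt_succ_self)).trans
      (interior_maximal (fun t ht => ⟨zero_le, le_of_lt ht⟩) isOpen_Iio)
  have hTmono : Monotone T := monotone_nat_of_le_succ fun n => (hT n).trans interior_subset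
  have hTc : ∀ n, IsCompact (T n) := fun n => isCompact_Icc
  have hint : ∀ n, T n ×ˢ K n ⊆ interior (T (n + 1) ×ˢ K (n + 1)) := fun n => by
    rw [interior_prod_eq]
    exact prod_mono (hT n) (K.subset_interior_succ n)
  have hU : ⋃ n, T n ×ˢ K n = univ := by
    refine eq_univ_of_forall fun z => ?_
    obtain ⟨m, hm⟩ := exists_nat_ge z.1
    obtain ⟨k, hk⟩ := K.exists_mem z.2
    exact mem_iUnion.2 ⟨max m k, hTmono (le_max_left m k) ⟨zero_le, hm⟩,
      K.subset (le_max_right m k) hk⟩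
  have hclosed : ∀ n, IsClosed (T n ×ˢ K n) := fun n => ((hTc n).prod (K.isCompact n)).isClosed
  obtain ⟨V, hV, hexc, hlim, hbd⟩ := exists_excessive_of_tendsto (q.jumpKernel_univ_le_one α)
    hFeller (hne.tendsto q hα) (fun n => (hTc n).prod (K.isCompact n)) hclosed hint hU
  exact ⟨T, fun n => K n, V, hTc, K.isCompact,
    { measurableSet := fun n => (hclosed n).measurableSet
      measurable := hV
      monotone := monotone_nat_of_le_succ fun n => (hint n).trans interior_subset
      iUnion_eq := hU
      rate_bounded := fun n => by
        obtain ⟨C, hC⟩ := hrate (K n) (K.isCompact n)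
        exact ⟨C, by rintro _ ⟨z, hz, rfl⟩; exact hC z.2 hz.2⟩
      tendsto_iInf := hlim
      drift := (q.kernelOp_le_iff_drift α hV).1 hexc }, hbd⟩
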